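/- All logarithms are to base $2$, and $0\log 0=0$. For $p\in[0,1]$, the depolarizing channel of probability $p$ acts on $n$ qubits by a random Pauli error $E=\otimes_{i=1}^n E_i$, where the $E_i$ are independent, each equal to $I$ with probability $1-p$ and to each of $X,Y,Z$ with probability $p/3$. Up to phase, $E=E_XE_Z$ with $E_X\in\{I,X\}^{\otimes n}$ and $E_Z\in\{I,Z\}^{\otimes n}$; let $e_X,e_Z\in\mathbb F_2^n$ be the corresponding binary vectors. A CSS code of length $n$ is the space of states in $(\mathbb C^2)^{\otimes n}$ fixed by finitely many commuting Pauli operators, each in $\{I,X\}^{\otimes n}$ or in $\{I,Z\}^{\otimes n}$; let the rows of the binary matrices $\mathbf H_X$, respectively $\mathbf H_Z$, describe the generators of the first, respectively second, kind. If the code space has dimension $2^k$, the quantum rate is $k/n$. The error $E$ has syndrome $s_X=\mathbf H_Xe_Z^T$, $s_Z=\mathbf H_Ze_X^T$. A CSS decoder using $X/Z$ correlations first computes from $s_Z$ a vector $\hat e_X$ of minimum weight with $\mathbf H_Z\hat e_X^T=s_Z$. It then erases the positions in the support of $\hat e_X$ and computes, from $s_X$ and the set of erased positions, a vector $\hat e_Z$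 with $\mathbf H_X\hat e_Z^T=s_X$ whose weight on the non-erased positions is minimum. Ties are broken in an arbitrary fixed way. Let $\hat E$ be the Pauli operator with components $\hat e_X,\hat e_Z$. Decoding succeeds on $E$ if $\hat E E$ acts on the code space as multiplication by a scalar of modulus $1$. **Theorem.** Let $p\in[0,1]$. For every $\varepsilon>0$ there is a family $(C_n)_{n\ge 1}$ of CSS codes, $C_n$ of length $n$, such that every $C_n$ has dimension $2^{k_n}$ for some integer $k_n \ge 0$ and quantum rate $$\frac{k_n}{n}\ \ge\ 1+p\log\frac p3+(1-p)\log(1-p)-\varepsilon ,$$ and such that, for every choice of CSS decoders using $X/Z$ correlations for the codes $C_n$, the probability over the depolarizing channel of probability $p$ that decoding fails on $C_n$ tends to $0$ as $n\to\infty$. -/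

import Mathlib

open Filter Topology

namespace CSS

/-- The four single-qubit Pauli labels. -/
inductive Pauli
  | I | X | Y | Z
  deriving DecidableEq

namespace Pauli

instance : Fintype Pauli := ⟨{I, X, Y, Z}, by rintro (_ | _ | _ | _) <;> decide⟩

/-- The usual Pauli matrices. -/
noncomputable def mat : Pauli → Matrix (Fin 2) (Fin 2) ℂ
  | I => !![1, 0; 0, 1]
  | X => !![0, 1; 1, 0]
  | Y => !![0, -Complex.I; Complex.I, 0]
  | Z => !![1, 0; 0, -1]

/-- The bit recording whether the `X` part of a Pauli label is nontrivial (`Y = XZ` up to phase). -/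
def xBit : Pauli → ZMod 2
  | I => 0 | X => 1 | Y => 1 | Z => 0

/-- The bit recording whether the `Z` part of a Pauli label is nontrivial. -/
def zBit : Pauli → ZMod 2
  | I => 0 | X => 0 | Y => 1 | Z => 1

/-- The Pauli label with `X` part `a` and `Z` part `b`. -/
def ofBits (a b : ZMod 2) : Pauli :=
  if a = 0 then (if b = 0 then I else Z) else (if b = 0 then X else Y)

/-- Single-qubit depolarizing channel: `I` with probability `1 - p`, and each of `X`, `Y`, `Z`
with probability `p / 3`. -/
noncomputable def depolarizing (p : ℝ) : Pauli → ℝ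
  | I => 1 - p
  | _ => p / 3

end Pauli

/-- `n`-qubit Pauli operators up to phase: the string `E` stands for `⊗ᵢ Eᵢ`. -/
abbrev PauliString (n : ℕ) := Fin n → Pauli

/-- The state space `(ℂ²)^{⊗ n}`, in coordinates on the computational basis `{0,1}ⁿ`. -/
abbrev QubitSpace (n : ℕ) := (Fin n → Fin 2) → ℂ

namespace PauliString

variable {n : ℕ}

/-- The matrix of the tensor product `⊗ᵢ Eᵢ` in the computational basis. -/
noncomputable def op (E : PauliString n) : Matrix (Fin n → Fin 2) (Fin n → Fin 2) ℂ :=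
  Matrix.of fun s t => ∏ i, (E i).mat (s i) (t i)

/-- The binary vector of the component `E_X`. -/
def xPart (E : PauliString n) : Fin n → ZMod 2 := fun i => (E i).xBit

/-- The binary vector of the component `E_Z`. -/
def zPart (E : PauliString n) : Fin n → ZMod 2 := fun i => (E i).zBit

/-- The Pauli string with components `E_X = a` and `E_Z = b`. -/
def ofParts (a b : Fin n → ZMod 2) : PauliString n := fun i => Pauli.ofBits (a i) (b i)

/-- The element of `{I, X}^{⊗ n}` described by a binary vector. -/
def xType (a : Fin n → ZMod 2) : PauliString n := ofParts a 0

/-- The element of `{I, Z}^{⊗ n}` described by a binary vector. -/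
def zType (b : Fin n → ZMod 2) : PauliString n := ofParts 0 b

open Classical in
/-- `E ⋆ S`: equal to `0` if the operators commute and to `1` otherwise. -/
noncomputable def anticomm (E S : PauliString n) : ZMod 2 :=
  if Commute E.op S.op then 0 else 1

/-- Probability of the error `E` when each qubit goes independently through the depolarizing
channel. -/
noncomputable def prob (p : ℝ) (E : PauliString n) : ℝ := ∏ i, (E i).depolarizing p

end PauliString

/-- A CSS code of length `n`: a finite family of generators in `{I, X}^{⊗ n}`, given by the rows of
`HX`, and a finite family of generators in `{I, Z}^{⊗ n}`, given by the rows of `HZ`, that commute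
(two generators of the same type always do). -/
structure CSSCode (n : ℕ) where
  rX : ℕ
  rZ : ℕ
  HX : Matrix (Fin rX) (Fin n) (ZMod 2)
  HZ : Matrix (Fin rZ) (Fin n) (ZMod 2)
  commute : ∀ i j,
    Commute (PauliString.xType (HX i)).op (PauliString.zType (HZ j)).op

namespace CSSCode

variable {n : ℕ} (C : CSSCode n)

/-- The quantum code: the space of states fixed by all generators. -/
def codeSpace : Submodule ℂ (QubitSpace n) where
  carrier := {ψ | (∀ i, (PauliString.xType (C.HX i)).op.mulVec ψ = ψ) ∧
    ∀ j, (PauliString.zType (C.HZ j)).op.mulVec ψ = ψ}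
  add_mem' := by
    rintro a b ⟨h1, h2⟩ ⟨h3, h4⟩
    exact ⟨fun i => by rw [Matrix.mulVec_add, h1, h3], fun i => by rw [Matrix.mulVec_add, h2, h4]⟩
  zero_mem' := ⟨fun i => Matrix.mulVec_zero _, fun i => Matrix.mulVec_zero _⟩
  smul_mem' := by
    rintro c a ⟨h1, h2⟩
    exact ⟨fun i => by rw [Matrix.mulVec_smul, h1], fun i => by rw [Matrix.mulVec_smul, h2]⟩

/-- The code encodes `k` qubits: the code space has dimension `2 ^ k`. -/
def Encodes (k : ℕ) : Prop := Module.finrank ℂ C.codeSpace = 2 ^ k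

/-- The part of the syndrome of `E` measured by the generators in `{I, X}^{⊗ n}`. -/
noncomputable def sX (E : PauliString n) : Fin C.rX → ZMod 2 :=
  fun i => E.anticomm (PauliString.xType (C.HX i))

/-- The part of the syndrome of `E` measured by the generators in `{I, Z}^{⊗ n}`. -/
noncomputable def sZ (E : PauliString n) : Fin C.rZ → ZMod 2 :=
  fun j => E.anticomm (PauliString.zType (C.HZ j))

end CSSCode

/-- The support of a binary vector. -/
def supp {n : ℕ} (e : Fin n → ZMod 2) : Finset (Fin n) := Finset.univ.filter fun i => e i ≠ 0

/-- `e` is an error estimate, for the binary code with parity-check matrix `H`, of syndrome `s`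
and, among all vectors of syndrome `s`, of minimum weight on the non-erased positions. With no
erased positions this is ordinary minimum-weight decoding. -/
def IsMinWeight {r n : ℕ} (H : Matrix (Fin r) (Fin n) (ZMod 2)) (s : Fin r → ZMod 2)
    (erased : Finset (Fin n)) (e : Fin n → ZMod 2) : Prop :=
  H.mulVec e = s ∧
    ∀ f : Fin n → ZMod 2, H.mulVec f = s → (supp e \ erased).card ≤ (supp f \ erased).card

/-- A CSS decoder using `X/Z` correlations for the code `C`. It first computes from the syndrome
part `s_Z` a minimum-weight estimate of the `X` component; then it decodes the `Z` component from
`s_X` as an errors-and-erasures problem. Ties are broken in an arbitrary but fixed way, and nothing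
is required for a syndrome that no error has. -/
structure CorrelatedDecoder {n : ℕ} (C : CSSCode n) where
  decodeX : (Fin C.rZ → ZMod 2) → (Fin n → ZMod 2)
  decodeZ : (Fin C.rX → ZMod 2) → Finset (Fin n) → (Fin n → ZMod 2)
  decodeX_spec : ∀ s, (∃ e, C.HZ.mulVec e = s) → IsMinWeight C.HZ s ∅ (decodeX s)
  decodeZ_spec : ∀ s erased, (∃ e, C.HX.mulVec e = s) →
    IsMinWeight C.HX s erased (decodeZ s erased)

namespace CorrelatedDecoder

variable {n : ℕ} {C : CSSCode n} (D : CorrelatedDecoder C)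

/-- The estimate computed from the syndrome of `E`: the `X` component comes first, and the positions
where an `X` error was found are the erased positions for the `Z` component. -/
noncomputable def decode (E : PauliString n) : PauliString n :=
  PauliString.ofParts (D.decodeX (C.sZ E))
    (D.decodeZ (C.sX E) (supp (D.decodeX (C.sZ E))))

/-- Decoding succeeds on `E`: the correction brings every encoded state hit by `E` back to
itself, up to one global phase. -/
def Succeeds (E : PauliString n) : Prop :=
  ∃ c : ℂ, ‖c‖ = 1 ∧ ∀ ψ ∈ C.codeSpace, (D.decode E).op.mulVec (E.op.mulVec ψ) = c • ψ

open Classical in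
/-- The probability, over the depolarizing channel of probability `p`, that decoding fails. -/
noncomputable def errorProb (p : ℝ) : ℝ :=
  ∑ E : PauliString n, if D.Succeeds E then 0 else E.prob p

end CorrelatedDecoder

/-- The hashing bound of the depolarizing channel. -/
noncomputable def hashingBound (p : ℝ) : ℝ :=
  1 + p * Real.logb 2 (p / 3) + (1 - p) * Real.logb 2 (1 - p)

/-- The sign attached to a bit. -/
def sign (b : ZMod 2) : ℂ := if b = 0 then 1 else -1

theorem sign_add (a b : ZMod 2) : sign (a + b) = sign a * sign b := by
  have h : ∀ a : ZMod 2, a = 0 ∨ a = 1 := by decide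
  have h2 : (1 : ZMod 2) + 1 = 0 := by decide
  rcases h a with rfl | rfl <;> rcases h b with rfl | rfl <;> simp [sign, h2]

theorem sign_sum {ι : Type*} (s : Finset ι) (b : ι → ZMod 2) :
    sign (∑ i ∈ s, b i) = ∏ i ∈ s, sign (b i) := by
  classical
  induction s using Finset.induction_on with
  | empty => simp [sign]
  | insert a s ha ih => rw [Finset.sum_insert ha, Finset.prod_insert ha, sign_add, ih]

theorem Pauli.mat_mul_comm (P Q : Pauli) :
    P.mat * Q.mat = sign (P.xBit * Q.zBit + P.zBit * Q.xBit) • (Q.mat * P.mat) := by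
  have h2 : (1 : ZMod 2) + 1 = 0 := by decide
  cases P <;> cases Q <;> simp [Pauli.mat, Pauli.xBit, Pauli.zBit, sign, h2]

theorem Pauli.mat_mul_self (P : Pauli) : P.mat * P.mat = 1 := by
  cases P <;> simp [Pauli.mat, Matrix.one_fin_two]

namespace PauliString

variable {n : ℕ}

theorem op_mul_apply (E S : PauliString n) (s t : Fin n → Fin 2) :
    (E.op * S.op) s t = ∏ i, ((E i).mat * (S i).mat) (s i) (t i) := by
  simp only [Matrix.mul_apply, op, Matrix.of_apply, Finset.prod_univ_sum, Fintype.piFinset_univ,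
    Finset.prod_mul_distrib]

theorem op_mul_self (E : PauliString n) : E.op * E.op = 1 := by
  ext s t
  rw [op_mul_apply]
  simp only [Pauli.mat_mul_self, Matrix.one_apply]
  by_cases h : s = t
  · simp [h]
  · obtain ⟨i, hi⟩ := Function.ne_iff.1 h
    rw [if_neg h]
    exact Finset.prod_eq_zero (Finset.mem_univ i) (if_neg hi)

theorem op_mul_comm (E S : PauliString n) :
    E.op * S.op = sign (E.xPart ⬝ᵥ S.zPart + E.zPart ⬝ᵥ S.xPart) • (S.op * E.op) := by
  ext s t
  rw [Matrix.smul_apply, op_mul_apply, op_mul_apply, dotProduct, dotProduct,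
    ← Finset.sum_add_distrib, sign_sum, smul_eq_mul, ← Finset.prod_mul_distrib]
  refine Finset.prod_congr rfl fun i _ => ?_
  rw [Pauli.mat_mul_comm]
  rfl

theorem anticomm_eq (E S : PauliString n) :
    E.anticomm S = E.xPart ⬝ᵥ S.zPart + E.zPart ⬝ᵥ S.xPart := by
  have h01 : ∀ a : ZMod 2, a = 0 ∨ a = 1 := by decide
  have h := op_mul_comm E S
  unfold anticomm
  rcases h01 (E.xPart ⬝ᵥ S.zPart + E.zPart ⬝ᵥ S.xPart) with h0 | h0 <;> rw [h0] at h ⊢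
  · rw [if_pos]
    have h' : E.op * S.op = S.op * E.op := by simpa [sign] using h
    exact h'
  · rw [if_neg]
    intro hc
    rw [hc.eq] at h
    have hz : S.op * E.op = 0 := by
      have : S.op * E.op = -(S.op * E.op) := by simpa [sign] using h
      ext s t
      exact self_eq_neg.1 (congrFun (congrFun this s) t)
    have h1 : (1 : Matrix (Fin n → Fin 2) (Fin n → Fin 2) ℂ) = 0 := by
      calc (1 : Matrix (Fin n → Fin 2) (Fin n → Fin 2) ℂ)
          = S.op * (S.op * E.op) * E.op := by
            rw [← mul_assoc, op_mul_self, one_mul, op_mul_self]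
        _ = 0 := by rw [hz, mul_zero, zero_mul]
    exact one_ne_zero h1

theorem xPart_ofParts (a b : Fin n → ZMod 2) : (ofParts a b).xPart = a := by
  have h : ∀ a b : ZMod 2, (Pauli.ofBits a b).xBit = a := by decide
  exact funext fun i => h _ _

theorem zPart_ofParts (a b : Fin n → ZMod 2) : (ofParts a b).zPart = b := by
  have h : ∀ a b : ZMod 2, (Pauli.ofBits a b).zBit = b := by decide
  exact funext fun i => h _ _

end PauliString

/-- The `X` syndrome is the binary syndrome `H_X e_Zᵀ`. -/
theorem CSSCode.sX_eq {n : ℕ} (C : CSSCode n) (E : PauliString n) :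
    C.sX E = C.HX.mulVec E.zPart := by
  funext i
  simp [CSSCode.sX, PauliString.anticomm_eq, PauliString.xType, PauliString.xPart_ofParts,
    PauliString.zPart_ofParts, Matrix.mulVec, dotProduct_comm]

/-- The `Z` syndrome is the binary syndrome `H_Z e_Xᵀ`. -/
theorem CSSCode.sZ_eq {n : ℕ} (C : CSSCode n) (E : PauliString n) :
    C.sZ E = C.HZ.mulVec E.xPart := by
  funext i
  simp [CSSCode.sZ, PauliString.anticomm_eq, PauliString.zType, PauliString.xPart_ofParts,
    PauliString.zPart_ofParts, Matrix.mulVec, dotProduct_comm]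

/-- Minimum-weight estimates exist for every attained syndrome. -/
theorem exists_isMinWeight {r n : ℕ} (H : Matrix (Fin r) (Fin n) (ZMod 2)) (s : Fin r → ZMod 2)
    (erased : Finset (Fin n)) (h : ∃ e, H.mulVec e = s) : ∃ e, IsMinWeight H s erased e := by
  classical
  obtain ⟨e, he⟩ := h
  obtain ⟨m, hm, hmin⟩ := Finset.exists_min_image
    (Finset.univ.filter fun e : Fin n → ZMod 2 => H.mulVec e = s)
    (fun e => (supp e \ erased).card) ⟨e, by simpa using he⟩
  exact ⟨m, by simpa using hm, fun f hf => hmin f (by simpa using hf)⟩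

/-- Every CSS code has a decoder of the kind above. -/
theorem CorrelatedDecoder.nonempty {n : ℕ} (C : CSSCode n) : Nonempty (CorrelatedDecoder C) := by
  classical
  exact ⟨{
    decodeX := fun s => if h : ∃ e, C.HZ.mulVec e = s then
      (exists_isMinWeight C.HZ s ∅ h).choose else 0
    decodeZ := fun s erased => if h : ∃ e, C.HX.mulVec e = s then
      (exists_isMinWeight C.HX s erased h).choose else 0
    decodeX_spec := fun s h => by
      simpa [h] using (exists_isMinWeight C.HZ s ∅ h).choose_spec
    decodeZ_spec := fun s erased h => by
      simpa [h] using (exists_isMinWeight C.HX s erased h).choose_spec }⟩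

end CSS

open scoped Matrix

namespace CSS

/-! Random coding. For a uniformly random `g` in `GL_n(F_2)`, some rows of `g` serve as `HX` and
other rows of the inverse transpose as `HZ`. The generators then commute automatically and the
dimension is exactly `2 ^ k` (`CSSCode.ofGL_encodes`), while `g` sends a fixed nonzero vector to a
uniform nonzero vector, so each parity-check matrix with `r` rows kills it with probability at most
`2⁻ʳ` (`card_GL_mulVec_eq_zero_le`). If decoding fails, one of the two stages has a competitor of
the same syndrome and no larger weight. A union bound over competitors, counted by exponential
weighting, bounds the average failure on a fixed `E` by terms `min 1 (∏ a / 2 ^ r)`. Since `min 1 x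
≤ x ^ ρ`, averaging over `E` factorizes over the qubits and decays exponentially once `r / n`
exceeds the mean of `log a` (`exists_sum_prod_mul_min_le`). With optimal weights the two means are
the entropy of the `X` bit and the conditional entropy of the `Z` bit. Nothing is lost on erased
positions, where the `Z` bit is uniform. By the chain rule the means add up to `1 - hashingBound p`.
-/

/-! ### Code states as functions on binary vectors. -/

theorem Pauli.mat_ofBits_zero_right (a x y : ZMod 2) :
    (Pauli.ofBits a 0).mat x y = if x = y + a then 1 else 0 := by
  have hI : ∀ x y : Fin 2, I.mat x y = if x = y + 0 then 1 else 0 := by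
    intro x y; fin_cases x <;> fin_cases y <;> simp [mat]
  have hX : ∀ x y : Fin 2, X.mat x y = if x = y + 1 then 1 else 0 := by
    intro x y; fin_cases x <;> fin_cases y <;> simp [mat]
  have h01 : ∀ a : ZMod 2, a = 0 ∨ a = 1 := by decide
  rcases h01 a with rfl | rfl
  · exact hI x y
  · exact hX x y

theorem Pauli.mat_ofBits_zero_left (b x y : ZMod 2) :
    (Pauli.ofBits 0 b).mat x y = if x = y then sign (b * y) else 0 := by
  have hI : ∀ x y : Fin 2, I.mat x y = if x = y then 1 else 0 := by
    intro x y; fin_cases x <;> fin_cases y <;> simp [mat]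
  have hZ : ∀ x y : Fin 2, Z.mat x y = if x = y then (if y = 0 then 1 else -1) else 0 := by
    intro x y; fin_cases x <;> fin_cases y <;> simp [mat]
  have h01 : ∀ a : ZMod 2, a = 0 ∨ a = 1 := by decide
  rcases h01 b with rfl | rfl
  · rw [zero_mul, sign, if_pos rfl]
    exact hI x y
  · rw [one_mul]
    exact hZ x y

/-- A computational basis label, read as a binary vector. -/
def bits (n : ℕ) : (Fin n → Fin 2) ≃ (Fin n → ZMod 2) := Equiv.refl _

namespace PauliString

variable {n : ℕ}

theorem xType_op_mulVec (a : Fin n → ZMod 2) (ψ : QubitSpace n) (s : Fin n → Fin 2) :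
    (xType a).op.mulVec ψ s = ψ ((bits n).symm (bits n s + a)) := by
  have h : ∀ t, (xType a).op s t = if t = (bits n).symm (bits n s + a) then 1 else 0 := by
    intro t
    have h1 : (xType a).op s t = ∏ i, if bits n s i = bits n t i + a i then (1 : ℂ) else 0 := by
      rw [op, Matrix.of_apply]
      exact Finset.prod_congr rfl fun i _ => Pauli.mat_ofBits_zero_right (a i) (bits n s i) (bits n t i)
    rw [h1]
    have h2 : ∀ x y z : ZMod 2, x = y + z ↔ y = x + z := by decide
    split_ifs with ht
    · refine Finset.prod_eq_one fun i _ => if_pos ?_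
      rw [h2, ht]
      simp
    · rw [Equiv.eq_symm_apply] at ht
      obtain ⟨i, hi⟩ := Function.ne_iff.1 ht
      exact Finset.prod_eq_zero (Finset.mem_univ i) (if_neg fun hc => hi ((h2 _ _ _).1 hc))
  simp [Matrix.mulVec, dotProduct, h]

theorem zType_op_mulVec (b : Fin n → ZMod 2) (ψ : QubitSpace n) (s : Fin n → Fin 2) :
    (zType b).op.mulVec ψ s = sign (b ⬝ᵥ bits n s) * ψ s := by
  have h : ∀ t, (zType b).op s t = if t = s then sign (b ⬝ᵥ bits n s) else 0 := by
    intro t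
    have h1 : (zType b).op s t =
        ∏ i, if bits n s i = bits n t i then sign (b i * bits n t i) else (0 : ℂ) := by
      rw [op, Matrix.of_apply]
      exact Finset.prod_congr rfl fun i _ => Pauli.mat_ofBits_zero_left (b i) (bits n s i) (bits n t i)
    rw [h1]
    split_ifs with ht
    · subst ht
      simp [dotProduct, sign_sum]
    · obtain ⟨i, hi⟩ := Function.ne_iff.1 ht
      exact Finset.prod_eq_zero (Finset.mem_univ i) (if_neg (Ne.symm hi))
  simp [Matrix.mulVec, dotProduct, h]

theorem ofParts_xPart_zPart (E : PauliString n) : ofParts E.xPart E.zPart = E := by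
  have h : ∀ P : Pauli, Pauli.ofBits P.xBit P.zBit = P := by decide
  exact funext fun i => h _

theorem prob_nonneg {p : ℝ} (hp0 : 0 ≤ p) (hp1 : p ≤ 1) (E : PauliString n) : 0 ≤ E.prob p := by
  refine Finset.prod_nonneg fun i _ => ?_
  cases E i <;> simp only [Pauli.depolarizing] <;> linarith

end PauliString

theorem sign_mul_eq_self_iff (b : ZMod 2) (z : ℂ) : sign b * z = z ↔ b ≠ 0 → z = 0 := by
  unfold sign
  split_ifs with h
  · simp [h]
  · simp [h, neg_eq_self]

/-- `X`-type operators translate basis labels and `Z`-type operators multiply by signs, so being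
fixed becomes an invariance condition and a support condition. -/
theorem CSSCode.mem_codeSpace_iff {n : ℕ} (C : CSSCode n) (ψ : QubitSpace n) :
    ψ ∈ C.codeSpace ↔
      (∀ i v, ψ ((bits n).symm (v + C.HX i)) = ψ ((bits n).symm v)) ∧
      ∀ j v, C.HZ j ⬝ᵥ v ≠ 0 → ψ ((bits n).symm v) = 0 := by
  refine Iff.intro (fun h => ⟨fun i v => ?_, fun j v hv => ?_⟩) fun h => ⟨fun i => ?_, fun j => ?_⟩
  · simpa [PauliString.xType_op_mulVec] using congrFun (h.1 i) ((bits n).symm v)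
  · have := congrFun (h.2 j) ((bits n).symm v)
    rw [PauliString.zType_op_mulVec, sign_mul_eq_self_iff] at this
    exact this (by simpa using hv)
  · funext s
    simpa [PauliString.xType_op_mulVec] using h.1 i (bits n s)
  · funext s
    rw [PauliString.zType_op_mulVec, sign_mul_eq_self_iff]
    simpa using h.2 j (bits n s)

theorem apply_add_vecMul_of_invariant {m n : ℕ} {β : Type*} (f : (Fin n → ZMod 2) → β)
    (h : Fin m → Fin n → ZMod 2) (hf : ∀ i v, f (v + h i) = f v) (c : Fin m → ZMod 2)
    (v : Fin n → ZMod 2) : f (v + ∑ i, c i • h i) = f v := by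
  have h01 : ∀ a : ZMod 2, a = 0 ∨ a = 1 := by decide
  generalize (Finset.univ : Finset (Fin m)) = s
  induction s using Finset.induction_on generalizing v with
  | empty => simp
  | insert a s ha ih =>
    rw [Finset.sum_insert ha, ← add_assoc, ih]
    rcases h01 (c a) with h0 | h0 <;> simp [h0, hf]

/-! ### CSS codes from an invertible matrix, and their dimension. -/

section OfGL

variable {n rX rZ k : ℕ} (e : Fin rX ⊕ Fin rZ ⊕ Fin k ≃ Fin n) (g : GL (Fin n) (ZMod 2))

/-- The CSS code whose `X` generators are given by `rX` rows of `g` and whose `Z` generators are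
given by `rZ` other rows of the inverse transpose of `g`. -/
def CSSCode.ofGL : CSSCode n where
  rX := rX
  rZ := rZ
  HX := fun i => g.1 (e (.inl i))
  HZ := fun j => g⁻¹.1.transpose (e (.inr (.inl j)))
  commute := by
    intro i j
    have h : (g.1 (e (.inl i))) ⬝ᵥ (g⁻¹.1.transpose (e (.inr (.inl j)))) = 0 := by
      have h1 : (g.1 * g⁻¹.1) (e (.inl i)) (e (.inr (.inl j))) = 0 := by
        rw [← Units.val_mul, mul_inv_cancel]
        exact Matrix.one_apply_ne (by simp)
      exact h1
    have h2 := PauliString.op_mul_comm (PauliString.xType (g.1 (e (.inl i))))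
      (PauliString.zType (g⁻¹.1.transpose (e (.inr (.inl j)))))
    simp only [PauliString.xType, PauliString.zType, PauliString.xPart_ofParts,
      PauliString.zPart_ofParts, h] at h2 ⊢
    rw [Commute, SemiconjBy]
    simpa [sign] using h2

/-- The vector with logical part `x`, in coordinates with respect to the rows of `g`, whose parts
along the `X` generators and the `Z` syndrome vanish. -/
def cosetRep (x : Fin k → ZMod 2) : Fin n → ZMod 2 :=
  Sum.elim 0 (Sum.elim 0 x) ∘ e.symm

theorem CSSCode.ofGL_HX (i : Fin rX) : (ofGL e g).HX i = Pi.single (e (.inl i)) 1 ᵥ* g.1 := by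
  rw [Matrix.single_one_vecMul]; rfl

/-- Rows of `HZ` are columns of `g⁻¹`, hence coordinate functionals for the basis formed by the rows
of `g`. -/
theorem CSSCode.ofGL_HZ_dotProduct (j : Fin rZ) (u : Fin n → ZMod 2) :
    (ofGL e g).HZ j ⬝ᵥ (u ᵥ* g.1) = u (e (.inr (.inl j))) := by
  have h : (u ᵥ* g.1) ᵥ* g⁻¹.1 = u := by
    rw [Matrix.vecMul_vecMul, ← Units.val_mul, mul_inv_cancel, Units.val_one, Matrix.vecMul_one]
  conv_rhs => rw [← h]
  rw [dotProduct_comm]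
  rfl

/-- A state of the code `CSSCode.ofGL`, restricted to the coset representatives `cosetRep`. -/
def CSSCode.ofGLEval : (ofGL e g).codeSpace →ₗ[ℂ] ((Fin k → ZMod 2) → ℂ) where
  toFun ψ x := ψ.1 ((bits n).symm (cosetRep e x ᵥ* g.1))
  map_add' _ _ := rfl
  map_smul' _ _ := rfl

/-- In row coordinates, `HX` makes a state independent of the first block and `HZ` makes it vanish
unless the second block is zero. Only the `k` logical coordinates remain. -/
theorem CSSCode.ofGLEval_injective : Function.Injective (ofGLEval e g) := by
  rw [injective_iff_map_eq_zero]
  rintro ⟨ψ, hψ⟩ h0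
  rw [mem_codeSpace_iff] at hψ
  have hv : ∀ v, ψ ((bits n).symm v) = 0 := by
    intro v
    obtain ⟨u, rfl⟩ : ∃ u, v = u ᵥ* g.1 := ⟨v ᵥ* g⁻¹.1, by
      rw [Matrix.vecMul_vecMul, ← Units.val_mul, inv_mul_cancel, Units.val_one,
        Matrix.vecMul_one]⟩
    by_cases hu : ∀ j, u (e (.inr (.inl j))) = 0
    · have h1 := congrFun h0 fun l => u (e (.inr (.inr l)))
      have h2 := apply_add_vecMul_of_invariant (fun v => ψ ((bits n).symm v))
        (fun i => (ofGL e g).HX i) hψ.1 (fun i => u (e (.inl i)))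
        (cosetRep e (fun l => u (e (.inr (.inr l)))) ᵥ* g.1)
      have h3 : cosetRep e (fun l => u (e (.inr (.inr l)))) ᵥ* g.1 +
          ∑ i : Fin rX, u (e (.inl i)) • (ofGL e g).HX i = u ᵥ* g.1 := by
        simp only [ofGL_HX, ← Matrix.smul_vecMul]
        rw [← Matrix.sum_vecMul, ← Matrix.add_vecMul]
        congr 1
        funext m
        obtain ⟨m, rfl⟩ := e.surjective m
        rcases m with i | j | l
        · simp [cosetRep, Pi.single_apply]
        · simp [cosetRep, hu]
        · simp [cosetRep]
      rw [← h3]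
      exact h2.trans h1
    · push Not at hu
      obtain ⟨j, hj⟩ := hu
      exact hψ.2 j _ (by rwa [ofGL_HZ_dotProduct])
  exact Subtype.ext (funext fun s => by simpa using hv (bits n s))

theorem CSSCode.ofGLEval_surjective : Function.Surjective (ofGLEval e g) := by
  classical
  intro f
  let φ : (Fin n → ZMod 2) → ℂ := fun u =>
    if ∀ j, u (e (.inr (.inl j))) = 0 then f (fun l => u (e (.inr (.inr l)))) else 0
  let ψ : QubitSpace n := fun s => φ (bits n s ᵥ* g⁻¹.1)
  have hinv : ∀ u : Fin n → ZMod 2, (u ᵥ* g.1) ᵥ* g⁻¹.1 = u := fun u => by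
    rw [Matrix.vecMul_vecMul, ← Units.val_mul, mul_inv_cancel, Units.val_one, Matrix.vecMul_one]
  have hinv' : ∀ u : Fin n → ZMod 2, (u ᵥ* g⁻¹.1) ᵥ* g.1 = u := fun u => by
    rw [Matrix.vecMul_vecMul, ← Units.val_mul, inv_mul_cancel, Units.val_one, Matrix.vecMul_one]
  have hψ : ψ ∈ (ofGL e g).codeSpace := by
    rw [mem_codeSpace_iff]
    refine ⟨fun (i : Fin rX) v => ?_, fun (j : Fin rZ) v hv => ?_⟩
    · rw [ofGL_HX]
      simp only [ψ, Equiv.apply_symm_apply, Matrix.add_vecMul, hinv]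
      simp [φ]
    · refine if_neg fun hc => hv ?_
      have h := ofGL_HZ_dotProduct e g j (v ᵥ* g⁻¹.1)
      rw [hinv'] at h
      exact h.trans (hc j)
  refine ⟨⟨ψ, hψ⟩, funext fun x => ?_⟩
  change φ (bits n ((bits n).symm (cosetRep e x ᵥ* g.1)) ᵥ* g⁻¹.1) = f x
  rw [Equiv.apply_symm_apply, hinv]
  simp [φ, cosetRep]

theorem CSSCode.ofGL_encodes : (ofGL e g).Encodes k := by
  rw [Encodes, (LinearEquiv.ofBijective (ofGLEval e g)
    ⟨ofGLEval_injective e g, ofGLEval_surjective e g⟩).finrank_eq]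
  simp

end OfGL

/-! ### Action of a random invertible matrix on a fixed vector. -/

section GeneralLinear

variable {n r : ℕ}

theorem exists_dotProduct_eq_one {x y : Fin n → ZMod 2} (hx : x ≠ 0) (hy : y ≠ 0) :
    ∃ c : Fin n → ZMod 2, c ⬝ᵥ x = 1 ∧ c ⬝ᵥ y = 1 := by
  have h01 : ∀ a : ZMod 2, a ≠ 0 → a = 1 := by decide
  obtain ⟨i, hi⟩ := Function.ne_iff.1 hx
  obtain ⟨j, hj⟩ := Function.ne_iff.1 hy
  replace hi := h01 _ hi
  replace hj := h01 _ hj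
  by_cases hyi : y i = 0
  · by_cases hxj : x j = 0
    · exact ⟨Pi.single i 1 + Pi.single j 1, by simp [add_dotProduct, *], by
        simp [add_dotProduct, *]⟩
    · exact ⟨Pi.single j 1, by simp [h01 _ hxj], by simp [hj]⟩
  · exact ⟨Pi.single i 1, by simp [hi], by simp [h01 _ hyi]⟩

/-- A transvection does it: `1 + (y - x) cᵀ` with `c ⬝ᵥ x = c ⬝ᵥ y = 1`. Then `c` annihilates `y -
x`, and in characteristic two the matrix is its own inverse. -/
theorem exists_GL_mulVec_eq {x y : Fin n → ZMod 2} (hx : x ≠ 0) (hy : y ≠ 0) :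
    ∃ g : GL (Fin n) (ZMod 2), g.1 *ᵥ x = y := by
  obtain ⟨c, hcx, hcy⟩ := exists_dotProduct_eq_one hx hy
  let A : Matrix (Fin n) (Fin n) (ZMod 2) := 1 + Matrix.vecMulVec (y - x) c
  have hA : ∀ z, A *ᵥ z = z + (c ⬝ᵥ z) • (y - x) := fun z => by
    rw [Matrix.add_mulVec, Matrix.one_mulVec, Matrix.vecMulVec_mulVec]
    simp
  have hAA : A * A = 1 := by
    apply Matrix.toLin'.injective
    refine LinearMap.ext fun z => ?_
    simp only [Matrix.toLin'_mul, Matrix.toLin'_apply, LinearMap.comp_apply, hA, dotProduct_add,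
      dotProduct_smul, dotProduct_sub, hcx, hcy, sub_self, smul_zero, add_zero, Matrix.toLin'_one,
      LinearMap.id_apply]
    rw [add_assoc, ← add_smul, CharTwo.add_self_eq_zero, zero_smul, add_zero]
  exact ⟨⟨A, A, hAA, hAA⟩, by simp [hA, hcx]⟩

/-- A uniformly random invertible matrix maps a nonzero vector to one that vanishes on `r` given
positions with probability at most `2⁻ʳ`. -/
theorem card_GL_mulVec_eq_zero_le {v : Fin n → ZMod 2} (hv : v ≠ 0) {J : Fin r → Fin n}
    (hJ : Function.Injective J) :
    (Finset.univ.filter fun g : GL (Fin n) (ZMod 2) => ∀ i, (g.1 *ᵥ v) (J i) = 0).card * 2 ^ r ≤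
      Fintype.card (GL (Fin n) (ZMod 2)) := by
  classical
  let N : (Fin n → ZMod 2) → ℕ := fun w =>
    (Finset.univ.filter fun g : GL (Fin n) (ZMod 2) => g.1 *ᵥ v = w).card
  -- Transitivity on nonzero vectors makes all these fibres equinumerous, via left translation.
  have hN : ∀ w, w ≠ 0 → N w = N v := by
    intro w hw
    obtain ⟨h, hh⟩ := exists_GL_mulVec_eq hv hw
    refine Finset.card_bij (fun g _ => h⁻¹ * g) ?_ (fun _ _ _ _ hab => mul_left_cancel hab) ?_
    · intro g hg
      simp only [Finset.mem_filter, Finset.mem_univ, true_and] at hg ⊢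
      rw [Units.val_mul, ← Matrix.mulVec_mulVec, hg, ← hh, Matrix.mulVec_mulVec, ← Units.val_mul,
        inv_mul_cancel, Units.val_one, Matrix.one_mulVec]
    · intro g hg
      refine ⟨h * g, ?_, by simp⟩
      simp only [Finset.mem_filter, Finset.mem_univ, true_and] at hg ⊢
      rw [Units.val_mul, ← Matrix.mulVec_mulVec, hg, hh]
  have hmem : ∀ g : GL (Fin n) (ZMod 2), g.1 *ᵥ v ≠ 0 := by
    intro g hg
    apply hv
    have : g⁻¹.1 *ᵥ (g.1 *ᵥ v) = v := by
      rw [Matrix.mulVec_mulVec, ← Units.val_mul, inv_mul_cancel, Units.val_one, Matrix.one_mulVec]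
    rw [← this, hg, Matrix.mulVec_zero]
  let W : Finset (Fin n → ZMod 2) := Finset.univ.filter fun w => ∀ i, w (J i) = 0
  have hcount : ∀ T : Finset (Fin n → ZMod 2),
      (Finset.univ.filter fun g : GL (Fin n) (ZMod 2) => g.1 *ᵥ v ∈ T).card =
        (T.erase 0).card * N v := by
    intro T
    rw [Finset.card_eq_sum_card_fiberwise (f := fun g : GL (Fin n) (ZMod 2) => g.1 *ᵥ v)
      (t := T.erase 0), ← smul_eq_mul, ← Finset.sum_const]
    · refine Finset.sum_congr rfl fun w hw => ?_
      rw [← hN w (Finset.ne_of_mem_erase hw), Finset.filter_filter]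
      congr 1
      ext g
      simp only [Finset.mem_filter, Finset.mem_univ, true_and]
      exact ⟨fun h => h.2, fun h => ⟨h ▸ Finset.mem_of_mem_erase hw, h⟩⟩
    · intro g hg
      simp only [Finset.coe_filter, Finset.mem_univ, true_and, Set.mem_ofPred_eq] at hg
      exact Finset.mem_coe.2 (Finset.mem_erase.2 ⟨hmem g, hg⟩)
  -- Adding arbitrary values on the positions `J` embeds `W × F_2^r` into `F_2^n`.
  have hW : W.card * 2 ^ r ≤ 2 ^ n := by
    have h : (W ×ˢ (Finset.univ : Finset (Fin r → ZMod 2))).card ≤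
        (Finset.univ : Finset (Fin n → ZMod 2)).card := by
      refine Finset.card_le_card_of_injOn
        (fun q => q.1 + Function.extend J q.2 0) (fun _ _ => by simp) ?_
      rintro ⟨w, a⟩ hw ⟨w', a'⟩ hw' h
      simp only [W, Finset.coe_product, Set.mem_prod, Finset.mem_coe, Finset.mem_filter,
        Finset.mem_univ, true_and] at hw hw'
      have ha : a = a' := funext fun i => by
        simpa [hJ.extend_apply, hw.1 i, hw'.1 i] using congrFun h (J i)
      subst ha
      simpa using h
    simpa [Finset.card_product, ZMod.card] using h
  have h1 := hcount W
  have h2 := hcount Finset.univ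
  have h0W : (0 : Fin n → ZMod 2) ∈ W := by simp [W]
  rw [Finset.card_erase_of_mem h0W] at h1
  rw [Finset.card_erase_of_mem (Finset.mem_univ _)] at h2
  simp only [W, Finset.mem_filter, Finset.mem_univ, true_and, Finset.filter_true,
    Finset.card_univ, Fintype.card_pi, ZMod.card, Finset.prod_const, Fintype.card_fin] at h1 h2
  -- Excluding the zero vector only helps: `(|W| - 1) 2^r = |W| 2^r - 2^r ≤ 2^n - 1`.
  rw [h1, h2, mul_right_comm]
  refine Nat.mul_le_mul_right _ ?_
  rw [Nat.sub_mul, one_mul]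
  exact (Nat.sub_le_sub_right hW _).trans (Nat.sub_le_sub_left Nat.one_le_two_pow _)

/-- Inverse transposition is an injection of the group into itself, so the estimate for `g` carries
over. -/
theorem card_GL_inv_transpose_mulVec_eq_zero_le {v : Fin n → ZMod 2} (hv : v ≠ 0)
    {J : Fin r → Fin n} (hJ : Function.Injective J) :
    (Finset.univ.filter fun g : GL (Fin n) (ZMod 2) =>
      ∀ i, (g⁻¹.1.transpose *ᵥ v) (J i) = 0).card * 2 ^ r ≤
        Fintype.card (GL (Fin n) (ZMod 2)) := by
  refine le_trans (Nat.mul_le_mul_right _ ?_) (card_GL_mulVec_eq_zero_le hv hJ)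
  refine Finset.card_le_card_of_injOn (fun g => ⟨g⁻¹.1.transpose, g.1.transpose, ?_, ?_⟩) ?_ ?_
  · rw [← Matrix.transpose_mul, ← Units.val_mul, mul_inv_cancel, Units.val_one,
      Matrix.transpose_one]
  · rw [← Matrix.transpose_mul, ← Units.val_mul, inv_mul_cancel, Units.val_one,
      Matrix.transpose_one]
  · intro g hg
    simpa using hg
  · intro g _ h _ hgh
    have := Matrix.transpose_injective (congrArg Units.val hgh)
    exact inv_injective (Units.ext this)

end GeneralLinear

/-! ### Union bound over competing error vectors. -/

theorem card_filter_exists_le {G V : Type*} [Fintype G] [DecidableEq V] (F : Finset V)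
    (P : G → V → Prop) [∀ g f, Decidable (P g f)] (r : ℕ)
    (h : ∀ f ∈ F, (Finset.univ.filter fun g => P g f).card * 2 ^ r ≤ Fintype.card G) :
    ((Finset.univ.filter fun g => ∃ f ∈ F, P g f).card : ℝ) ≤
      Fintype.card G * min 1 ((F.card : ℝ) / 2 ^ r) := by
  classical
  rw [mul_min_of_nonneg _ _ (Nat.cast_nonneg _), mul_one]
  refine le_min (Nat.cast_le.2 (Finset.card_le_univ _)) ?_
  have h1 : (Finset.univ.filter fun g => ∃ f ∈ F, P g f) ⊆
      F.biUnion fun f => Finset.univ.filter fun g => P g f := by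
    intro g
    simp
  have h2 : (Finset.univ.filter fun g => ∃ f ∈ F, P g f).card * 2 ^ r ≤
      Fintype.card G * F.card := by
    calc _ ≤ (∑ f ∈ F, (Finset.univ.filter fun g => P g f).card) * 2 ^ r :=
          Nat.mul_le_mul_right _ ((Finset.card_le_card h1).trans Finset.card_biUnion_le)
      _ = ∑ f ∈ F, (Finset.univ.filter fun g => P g f).card * 2 ^ r := Finset.sum_mul _ _ _
      _ ≤ ∑ f ∈ F, Fintype.card G := Finset.sum_le_sum h
      _ = _ := by rw [Finset.sum_const, smul_eq_mul, mul_comm]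
  rw [← mul_div_assoc, le_div_iff₀ (by positivity)]
  exact_mod_cast h2

theorem mem_supp {n : ℕ} {e : Fin n → ZMod 2} {i : Fin n} : i ∈ supp e ↔ e i ≠ 0 := by
  simp [supp]

/-- Single-position factor in the exponential bound on the number of vectors that are at most as
heavy as a given one on the non-erased positions. -/
noncomputable def weightFactor (μ : ℝ) (erased : Prop) [Decidable erased] (x : ZMod 2) : ℝ :=
  if erased then 2 else if x = 0 then 1 + μ else (1 + μ) / μ

theorem weightFactor_congr (μ : ℝ) {a b : Prop} [Decidable a] [Decidable b] (h : a ↔ b)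
    (x : ZMod 2) : weightFactor μ a x = weightFactor μ b x := by
  simp only [weightFactor, h]

/-- Chernoff-type count: give `f` the weight `μ ^ (supp f \ S).card`. As `μ ≤ 1`, every counted `f`
weighs at least as much as `e`, so the count is at most the total weight, a product over positions,
divided by the weight of `e`. -/
theorem card_weight_le_weight_le {n : ℕ} {μ : ℝ} (h0 : 0 < μ) (h1 : μ ≤ 1) (S : Finset (Fin n))
    (e : Fin n → ZMod 2) :
    ((Finset.univ.filter fun f : Fin n → ZMod 2 =>
      (supp f \ S).card ≤ (supp e \ S).card).card : ℝ) ≤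
        ∏ i, weightFactor μ (i ∈ S) (e i) := by
  let t : Fin n → ZMod 2 → ℝ := fun i x => if i ∈ S then 1 else if x = 0 then 1 else μ
  have ht : ∀ i x, 0 < t i x := by
    intro i x
    dsimp only [t]
    split_ifs <;> positivity
  have hpow : ∀ f : Fin n → ZMod 2, ∏ i, t i (f i) = μ ^ (supp f \ S).card := by
    intro f
    rw [← Finset.prod_const, supp, ← Finset.filter_notMem_eq_sdiff, Finset.filter_filter,
      Finset.prod_filter]
    refine Finset.prod_congr rfl fun i _ => ?_
    by_cases hi : i ∈ S <;> by_cases hf : f i = 0 <;> simp [t, hi, hf]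
  have hfac : ∀ i, weightFactor μ (i ∈ S) (e i) = (∑ x, t i x) / t i (e i) := by
    intro i
    have hs : ∑ x, t i x = t i 0 + t i 1 := Fin.sum_univ_two (t i)
    rw [hs]
    by_cases hi : i ∈ S <;> by_cases he : e i = 0 <;>
      simp [t, weightFactor, hi, he, one_add_one_eq_two]
  simp only [hfac]
  rw [Finset.prod_div_distrib, Finset.prod_univ_sum, Fintype.piFinset_univ,
    le_div_iff₀ (Finset.prod_pos fun i _ => ht i _), ← nsmul_eq_mul, ← Finset.sum_const]
  refine (Finset.sum_le_sum fun f hf => ?_).trans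
    (Finset.sum_le_sum_of_subset_of_nonneg (Finset.filter_subset _ _) fun f _ _ =>
      Finset.prod_nonneg fun i _ => (ht i _).le)
  rw [hpow, hpow]
  exact pow_le_pow_of_le_one h0.le h1 (by simpa using hf)

/-- Some other vector with the same syndrome as `e` is at most as heavy as `e` on the non-erased
positions. -/
def Confusable {r n : ℕ} (H : Matrix (Fin r) (Fin n) (ZMod 2)) (S : Finset (Fin n))
    (e : Fin n → ZMod 2) : Prop :=
  ∃ f, f ≠ e ∧ H.mulVec f = H.mulVec e ∧ (supp f \ S).card ≤ (supp e \ S).card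

theorem IsMinWeight.eq_of_not_confusable {r n : ℕ} {H : Matrix (Fin r) (Fin n) (ZMod 2)}
    {S : Finset (Fin n)} {e f : Fin n → ZMod 2} (h : IsMinWeight H (H.mulVec e) S f)
    (he : ¬Confusable H S e) : f = e :=
  by_contra fun hne => he ⟨f, hne, h.1, h.2 e rfl⟩

open Classical in
theorem card_confusable_le {G : Type*} [Fintype G] {r n : ℕ}
    (H : G → Matrix (Fin r) (Fin n) (ZMod 2))
    (hH : ∀ v, v ≠ 0 →
      (Finset.univ.filter fun g => H g *ᵥ v = 0).card * 2 ^ r ≤ Fintype.card G)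
    {μ : ℝ} (h0 : 0 < μ) (h1 : μ ≤ 1) (S : Finset (Fin n)) (e : Fin n → ZMod 2) :
    ((Finset.univ.filter fun g => Confusable (H g) S e).card : ℝ) ≤
      Fintype.card G * min 1 ((∏ i, weightFactor μ (i ∈ S) (e i)) / 2 ^ r) := by
  let F : Finset (Fin n → ZMod 2) := Finset.univ.filter fun f =>
    f ≠ e ∧ (supp f \ S).card ≤ (supp e \ S).card
  have hF : (F.card : ℝ) ≤ ∏ i, weightFactor μ (i ∈ S) (e i) := by
    refine le_trans ?_ (card_weight_le_weight_le h0 h1 S e)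
    exact_mod_cast Finset.card_le_card fun f hf => by
      simp only [F, Finset.mem_filter, Finset.mem_univ, true_and] at hf ⊢
      exact hf.2
  have h := card_filter_exists_le F (fun g f => H g *ᵥ f = H g *ᵥ e) r (fun f hf => by
    simp only [F, Finset.mem_filter, Finset.mem_univ, true_and] at hf
    simpa [Matrix.mulVec_sub, sub_eq_zero] using hH (f - e) (sub_ne_zero.2 hf.1))
  have heq : (Finset.univ.filter fun g => ∃ f ∈ F, H g *ᵥ f = H g *ᵥ e) =
      Finset.univ.filter fun g => Confusable (H g) S e := by
    ext g
    simp only [F, Finset.mem_filter, Finset.mem_univ, true_and]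
    exact exists_congr fun f => ⟨fun h => ⟨h.1.1, h.2, h.1.2⟩, fun h => ⟨⟨h.1, h.2.2⟩, h.2.1⟩⟩
  rw [heq] at h
  refine h.trans ?_
  gcongr

/-! ### Failure probability and its average over random codes. -/

namespace CorrelatedDecoder

variable {n : ℕ} {C : CSSCode n} (D : CorrelatedDecoder C)

/-- Without competitors both estimates are exact; in particular the second stage erases exactly the
support of the true `X` error. The correction then squares `E` to the identity. -/
theorem confusable_of_not_succeeds {E : PauliString n} (h : ¬D.Succeeds E) :
    Confusable C.HZ ∅ E.xPart ∨ Confusable C.HX (supp E.xPart) E.zPart := by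
  by_contra! hc
  have hX : D.decodeX (C.sZ E) = E.xPart := by
    rw [C.sZ_eq]
    exact (D.decodeX_spec _ ⟨_, rfl⟩).eq_of_not_confusable hc.1
  have hZ : D.decodeZ (C.sX E) (supp E.xPart) = E.zPart := by
    rw [C.sX_eq]
    exact (D.decodeZ_spec _ _ ⟨_, rfl⟩).eq_of_not_confusable hc.2
  have hE : D.decode E = E := by
    rw [decode, hX, hZ, PauliString.ofParts_xPart_zPart]
  refine h ⟨1, by simp, fun ψ _ => ?_⟩
  rw [hE, Matrix.mulVec_mulVec, PauliString.op_mul_self, Matrix.one_mulVec, one_smul]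

open Classical in
theorem errorProb_le {p : ℝ} (hp0 : 0 ≤ p) (hp1 : p ≤ 1) :
    D.errorProb p ≤ ∑ E : PauliString n, E.prob p *
      ((if Confusable C.HZ ∅ E.xPart then 1 else 0) +
        (if Confusable C.HX (supp E.xPart) E.zPart then 1 else 0)) := by
  refine Finset.sum_le_sum fun E _ => ?_
  have hE := E.prob_nonneg hp0 hp1
  by_cases hs : D.Succeeds E
  · rw [if_pos hs]
    positivity
  · rw [if_neg hs]
    refine le_mul_of_one_le_right hE ?_
    rcases D.confusable_of_not_succeeds hs with h | h
    · rw [if_pos h]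
      exact le_add_of_nonneg_right (by positivity)
    · rw [if_pos h]
      exact le_add_of_nonneg_left (by positivity)

theorem errorProb_nonneg {p : ℝ} (hp0 : 0 ≤ p) (hp1 : p ≤ 1) : 0 ≤ D.errorProb p :=
  Finset.sum_nonneg fun E _ => by
    split_ifs
    · exact le_rfl
    · exact E.prob_nonneg hp0 hp1

end CorrelatedDecoder

/-- Random coding bound: some code with given numbers of generators has error probability at most
the average over a random choice of the generators. -/
theorem exists_code_errorProb_le {n rX rZ k : ℕ} (e : Fin rX ⊕ Fin rZ ⊕ Fin k ≃ Fin n)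
    {p : ℝ} (hp0 : 0 ≤ p) (hp1 : p ≤ 1) {μ ν : ℝ} (hμ0 : 0 < μ) (hμ1 : μ ≤ 1)
    (hν0 : 0 < ν) (hν1 : ν ≤ 1) :
    ∃ C : CSSCode n, C.Encodes k ∧ ∀ D : CorrelatedDecoder C, D.errorProb p ≤
      (∑ E : PauliString n, E.prob p *
        min 1 ((∏ i, weightFactor μ False (E i).xBit) / 2 ^ rZ)) +
      ∑ E : PauliString n, E.prob p *
        min 1 ((∏ i, weightFactor ν ((E i).xBit ≠ 0) (E i).zBit) / 2 ^ rX) := by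
  classical
  let G := GL (Fin n) (ZMod 2)
  let A : G → PauliString n → ℝ := fun g E =>
    (if Confusable (CSSCode.ofGL e g).HZ ∅ E.xPart then 1 else 0) +
      (if Confusable (CSSCode.ofGL e g).HX (supp E.xPart) E.zPart then 1 else 0)
  let B : PauliString n → ℝ := fun E =>
    min 1 ((∏ i, weightFactor μ False (E i).xBit) / 2 ^ rZ) +
      min 1 ((∏ i, weightFactor ν ((E i).xBit ≠ 0) (E i).zBit) / 2 ^ rX)
  have hAB : ∀ E, ∑ g, A g E ≤ Fintype.card G * B E := by
    intro E
    have hZ := card_confusable_le (fun g : G => (CSSCode.ofGL e g).HZ)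
      (fun v hv => by
        convert card_GL_inv_transpose_mulVec_eq_zero_le hv (J := fun j => e (.inr (.inl j)))
          (fun a b h => by simpa using h) using 4
        exact funext_iff)
      hμ0 hμ1 ∅ E.xPart
    have hX := card_confusable_le (fun g : G => (CSSCode.ofGL e g).HX)
      (fun v hv => by
        convert card_GL_mulVec_eq_zero_le hv (J := fun j => e (.inl j))
          (fun a b h => by simpa using h) using 4
        exact funext_iff)
      hν0 hν1 (supp E.xPart) E.zPart
    simp only [A, B, Finset.sum_add_distrib, Finset.sum_boole, mul_add]
    have hwZ : ∏ i, weightFactor μ (i ∈ (∅ : Finset (Fin n))) (E.xPart i) =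
        ∏ i, weightFactor μ False (E i).xBit :=
      Finset.prod_congr rfl fun i _ => weightFactor_congr μ (by simp) _
    have hwX : ∏ i, weightFactor ν (i ∈ supp E.xPart) (E.zPart i) =
        ∏ i, weightFactor ν ((E i).xBit ≠ 0) (E i).zBit :=
      Finset.prod_congr rfl fun i _ => weightFactor_congr ν mem_supp _
    rw [hwZ] at hZ
    rw [hwX] at hX
    exact add_le_add hZ hX
  have hsum : ∑ g : G, ∑ E, E.prob p * A g E ≤ ∑ g : G, ∑ E, E.prob p * B E := by
    rw [Finset.sum_comm, Finset.sum_const, nsmul_eq_mul, Finset.mul_sum]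
    refine Finset.sum_le_sum fun E _ => ?_
    rw [← Finset.mul_sum, mul_left_comm]
    exact mul_le_mul_of_nonneg_left (hAB E) (E.prob_nonneg hp0 hp1)
  -- The averaged quantity `A` involves no decoder, so a single `g` serves every `D`.
  obtain ⟨g, -, hg⟩ := Finset.exists_le_of_sum_le Finset.univ_nonempty hsum
  refine ⟨CSSCode.ofGL e g, CSSCode.ofGL_encodes e g, fun D => ?_⟩
  refine (D.errorProb_le hp0 hp1).trans (hg.trans_eq ?_)
  simp only [B, mul_add, Finset.sum_add_distrib]

/-! ### Exponential decay above the critical rate. -/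

/-- As a function of `ρ` the moment equals `1` at `0`, with derivative `log 2` times (mean of `logb
2 a` minus `R`), which is negative. -/
theorem exists_rpow_moment_lt_one {ι : Type*} [Fintype ι] {w a : ι → ℝ} (hsum : ∑ x, w x = 1)
    (ha : ∀ x, 0 < a x) {R : ℝ} (h : ∑ x, w x * Real.logb 2 (a x) < R) :
    ∃ ρ : ℝ, 0 < ρ ∧ ρ ≤ 1 ∧ ∑ x, w x * (a x / 2 ^ R) ^ ρ < 1 := by
  have hd : HasDerivAt (fun ρ : ℝ => ∑ x, w x * (a x / 2 ^ R) ^ ρ)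
      (∑ x, w x * ((a x / 2 ^ R) ^ (0 : ℝ) * Real.log (a x / 2 ^ R))) 0 :=
    HasDerivAt.fun_sum fun x _ =>
      (Real.hasStrictDerivAt_const_rpow (div_pos (ha x) (by positivity)) 0).hasDerivAt.const_mul _
  have h2 : (0 : ℝ) < Real.log 2 := Real.log_pos one_lt_two
  have hneg : ∑ x, w x * ((a x / 2 ^ R) ^ (0 : ℝ) * Real.log (a x / 2 ^ R)) < 0 := by
    have : ∑ x, w x * ((a x / 2 ^ R) ^ (0 : ℝ) * Real.log (a x / 2 ^ R)) =
        Real.log 2 * (∑ x, w x * Real.logb 2 (a x) - R * ∑ x, w x) := by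
      rw [Finset.mul_sum, ← Finset.sum_sub_distrib, Finset.mul_sum]
      refine Finset.sum_congr rfl fun x _ => ?_
      rw [Real.rpow_zero, one_mul, Real.log_div (ha x).ne' (by positivity),
        Real.log_rpow two_pos, Real.logb]
      field_simp
    rw [this, hsum, mul_one]
    exact mul_neg_of_pos_of_neg h2 (sub_neg.2 h)
  have hev := (hd.hasDerivWithinAt (s := Set.Ioi 0)).limsup_slope_le' (lt_irrefl _) hneg
  obtain ⟨ρ, hρ, hρ0, hρ1⟩ := (hev.and (Ioc_mem_nhdsGT one_pos)).exists
  refine ⟨ρ, hρ0, hρ1, ?_⟩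
  rw [slope_def_field, div_lt_iff₀ (by simpa using hρ0)] at hρ
  simp only [Real.rpow_zero, mul_one, hsum, zero_mul] at hρ
  linarith

theorem min_one_le_rpow {x ρ : ℝ} (hx : 0 < x) (h0 : 0 ≤ ρ) (h1 : ρ ≤ 1) : min 1 x ≤ x ^ ρ := by
  rcases le_total x 1 with h | h
  · refine (min_le_right _ _).trans ?_
    simpa using Real.rpow_le_rpow_of_exponent_ge hx h h1
  · exact (min_le_left _ _).trans (Real.one_le_rpow h h0)

/-- If the mean of `log a` under `w` is less than `R`, then `min 1 (∏ i, a (E i) / 2 ^ (R * n))` is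
exponentially small on average. -/
theorem exists_sum_prod_mul_min_le {ι : Type*} [Fintype ι] {w a : ι → ℝ} (hw : ∀ x, 0 ≤ w x)
    (hsum : ∑ x, w x = 1) (ha : ∀ x, 0 < a x) {R : ℝ}
    (h : ∑ x, w x * Real.logb 2 (a x) < R) :
    ∃ c : ℝ, 0 ≤ c ∧ c < 1 ∧ ∀ n r : ℕ, R * n - 1 ≤ r →
      ∑ E : Fin n → ι, (∏ i, w (E i)) * min 1 ((∏ i, a (E i)) / 2 ^ r) ≤ 2 * c ^ n := by
  obtain ⟨ρ, h0, h1, hlt⟩ := exists_rpow_moment_lt_one hsum ha h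
  have hb : ∀ x, 0 < a x / 2 ^ R := fun x => div_pos (ha x) (by positivity)
  refine ⟨_, Finset.sum_nonneg fun x _ => mul_nonneg (hw x) (Real.rpow_nonneg (hb x).le ρ), hlt,
    fun n r hr => ?_⟩
  rw [Fintype.sum_pow, Finset.mul_sum]
  refine Finset.sum_le_sum fun E _ => ?_
  rw [Finset.prod_mul_distrib, mul_left_comm]
  refine mul_le_mul_of_nonneg_left ?_ (Finset.prod_nonneg fun i _ => hw _)
  have hP : 0 < ∏ i, a (E i) := Finset.prod_pos fun i _ => ha _
  refine (min_one_le_rpow (by positivity) h0.le h1).trans ?_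
  -- The factor `2` absorbs the possible rounding loss of one syndrome bit.
  have hle : (∏ i, a (E i)) / 2 ^ r ≤ 2 * ∏ i, a (E i) / 2 ^ R := by
    rw [Finset.prod_div_distrib, Finset.prod_const, Finset.card_univ, Fintype.card_fin,
      ← Real.rpow_mul_natCast two_pos.le, ← mul_div_assoc, ← Real.rpow_natCast 2 r,
      div_le_div_iff₀ (by positivity) (by positivity)]
    have : (2 : ℝ) ^ (R * n) ≤ 2 * 2 ^ (r : ℝ) := by
      rw [mul_comm (2 : ℝ) (2 ^ (r : ℝ)), ← Real.rpow_add_one two_ne_zero]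
      exact Real.rpow_le_rpow_of_exponent_le one_le_two (by linarith)
    nlinarith
  refine (Real.rpow_le_rpow (by positivity) hle h0.le).trans ?_
  rw [Real.mul_rpow two_pos.le (Finset.prod_nonneg fun i _ => (hb _).le),
    ← Real.finsetProd_rpow _ _ fun i _ => (hb _).le]
  refine mul_le_mul_of_nonneg_right ?_
    (Finset.prod_nonneg fun i _ => Real.rpow_nonneg (hb _).le ρ)
  simpa using Real.rpow_le_rpow_of_exponent_le one_le_two h1

/-! ### Entropy computation and choice of the weights. -/

theorem one_le_weightFactor {μ : ℝ} (h0 : 0 < μ) (erased : Prop) [Decidable erased]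
    (x : ZMod 2) : 1 ≤ weightFactor μ erased x := by
  unfold weightFactor
  split_ifs
  · exact one_le_two
  · linarith
  · rw [le_div_iff₀ h0]
    linarith

theorem Pauli.sum_eq (f : Pauli → ℝ) : ∑ P, f P = f I + f X + f Y + f Z := by
  have h : (Finset.univ : Finset Pauli) = {I, X, Y, Z} := rfl
  rw [h, Finset.sum_insert (by decide), Finset.sum_insert (by decide),
    Finset.sum_insert (by decide), Finset.sum_singleton]
  ring

theorem Pauli.depolarizing_nonneg {p : ℝ} (hp0 : 0 ≤ p) (hp1 : p ≤ 1) (P : Pauli) :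
    0 ≤ P.depolarizing p := by
  cases P <;> simp only [depolarizing] <;> linarith

theorem Pauli.sum_depolarizing (p : ℝ) : ∑ P : Pauli, P.depolarizing p = 1 := by
  simp only [sum_eq, depolarizing]
  ring

/-- Rate, in syndrome bits per qubit, that suffices for the `X` component. -/
noncomputable def rateX (p μ : ℝ) : ℝ :=
  ∑ P : Pauli, P.depolarizing p * Real.logb 2 (weightFactor μ False P.xBit)

/-- Rate, in syndrome bits per qubit, that suffices for the `Z` component once the `X` component is
known. -/
noncomputable def rateZ (p ν : ℝ) : ℝ :=
  ∑ P : Pauli, P.depolarizing p * Real.logb 2 (weightFactor ν (P.xBit ≠ 0) P.zBit)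

theorem rateX_nonneg {p μ : ℝ} (hp0 : 0 ≤ p) (hp1 : p ≤ 1) (h0 : 0 < μ) :
    0 ≤ rateX p μ :=
  Finset.sum_nonneg fun P _ => mul_nonneg (P.depolarizing_nonneg hp0 hp1)
    (Real.logb_nonneg one_lt_two (one_le_weightFactor h0 _ _))

theorem rateZ_nonneg {p ν : ℝ} (hp0 : 0 ≤ p) (hp1 : p ≤ 1) (h0 : 0 < ν) :
    0 ≤ rateZ p ν :=
  Finset.sum_nonneg fun P _ => mul_nonneg (P.depolarizing_nonneg hp0 hp1)
    (Real.logb_nonneg one_lt_two (one_le_weightFactor h0 _ _))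

theorem rateX_eq (p : ℝ) {μ : ℝ} (h0 : 0 < μ) :
    rateX p μ = Real.logb 2 (1 + μ) - 2 * p / 3 * Real.logb 2 μ := by
  have h : Real.logb 2 ((1 + μ) / μ) = Real.logb 2 (1 + μ) - Real.logb 2 μ :=
    Real.logb_div (by positivity) h0.ne'
  simp [rateX, Pauli.sum_eq, Pauli.depolarizing, Pauli.xBit, weightFactor, h]
  ring

theorem rateZ_eq (p : ℝ) {ν : ℝ} (h0 : 0 < ν) :
    rateZ p ν = 2 * p / 3 + (1 - 2 * p / 3) * Real.logb 2 (1 + ν) - p / 3 * Real.logb 2 ν := by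
  have h : Real.logb 2 ((1 + ν) / ν) = Real.logb 2 (1 + ν) - Real.logb 2 ν :=
    Real.logb_div (by positivity) h0.ne'
  simp [rateZ, Pauli.sum_eq, Pauli.depolarizing, Pauli.xBit, Pauli.zBit, weightFactor, h]
  ring

/-- Here `p / 3 ≤ 1 / 3`, and `2 ^ 4 ≤ 3 ^ 3` gives `logb 2 3 ≥ 4 / 3`, so the term in `p` is at
most `-1`. -/
theorem hashingBound_nonpos {p : ℝ} (hp : 3 / 4 ≤ p) (hp1 : p ≤ 1) : hashingBound p ≤ 0 := by
  have h3 : 4 / 3 ≤ Real.logb 2 3 := by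
    have h27 : Real.logb 2 ((3 : ℝ) ^ 3) = 3 * Real.logb 2 3 := by
      rw [Real.logb_pow]
      norm_num
    have h16 : Real.logb 2 ((2 : ℝ) ^ 4) = 4 := by
      rw [Real.logb_pow]
      simp
    have := Real.logb_le_logb_of_le one_lt_two (by norm_num) (show (2 : ℝ) ^ 4 ≤ 3 ^ 3 by norm_num)
    linarith
  have h1 : Real.logb 2 (p / 3) ≤ -Real.logb 2 3 := by
    rw [← Real.logb_inv]
    exact Real.logb_le_logb_of_le one_lt_two (by positivity) (by linarith)
  have h2 : Real.logb 2 (1 - p) ≤ 0 :=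
    Real.logb_nonpos one_lt_two (by linarith) (by linarith)
  unfold hashingBound
  nlinarith

/-- For `p > 0`, `μ` is the odds of an `X` bit and `ν` the odds of a `Z` bit given no `X` bit; `p <
3 / 4` keeps both at most `1`. The rates become the entropies in the chain rule, with equality even
without `δ`. -/
theorem exists_rateX_add_rateZ_le {p : ℝ} (hp0 : 0 ≤ p) (hp : p < 3 / 4) {δ : ℝ} (hδ : 0 < δ) :
    ∃ μ ν : ℝ, 0 < μ ∧ μ ≤ 1 ∧ 0 < ν ∧ ν ≤ 1 ∧ rateX p μ + rateZ p ν ≤ 1 - hashingBound p + δ := by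
  rcases hp0.eq_or_lt with rfl | hp0
  · have h1 : (1 : ℝ) < 2 ^ (δ / 2) := Real.one_lt_rpow one_lt_two (by linarith)
    have hμ : 0 < min 1 ((2 : ℝ) ^ (δ / 2) - 1) := lt_min one_pos (by linarith)
    refine ⟨_, _, hμ, min_le_left _ _, hμ, min_le_left _ _, ?_⟩
    have hlog : Real.logb 2 (1 + min 1 ((2 : ℝ) ^ (δ / 2) - 1)) ≤ δ / 2 := by
      rw [Real.logb_le_iff_le_rpow one_lt_two (by positivity)]
      linarith [min_le_right 1 ((2 : ℝ) ^ (δ / 2) - 1)]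
    rw [rateX_eq 0 hμ, rateZ_eq 0 hμ]
    simp only [hashingBound, sub_zero, Real.logb_one]
    linarith
  · have hq : 0 < 1 - p := by linarith
    have hs : 0 < 1 - 2 * p / 3 := by linarith
    have hμ : 0 < 2 * p / 3 / (1 - 2 * p / 3) := by positivity
    have hν : 0 < p / 3 / (1 - p) := by positivity
    refine ⟨_, _, hμ, ?_, hν, ?_, ?_⟩
    · rw [div_le_one hs]
      linarith
    · rw [div_le_one hq]
      linarith
    · have e1 : 1 + 2 * p / 3 / (1 - 2 * p / 3) = (1 - 2 * p / 3)⁻¹ := by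
        refine eq_inv_of_mul_eq_one_left ?_
        rw [add_mul, div_mul_cancel₀ _ hs.ne']
        ring
      have e2 : 1 + p / 3 / (1 - p) = (1 - 2 * p / 3) / (1 - p) := by
        field_simp
        ring
      have e3 : 2 * p / 3 = 2 * (p / 3) := by ring
      have l3 : Real.logb 2 (2 * p / 3) = 1 + Real.logb 2 (p / 3) := by
        rw [e3, Real.logb_mul two_ne_zero (by positivity), Real.logb_self_eq_one one_lt_two]
      rw [rateX_eq p hμ, rateZ_eq p hν, e1, e2, Real.logb_inv,
        Real.logb_div hs.ne' hq.ne', Real.logb_div (by positivity) hs.ne', l3,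
        Real.logb_div (by positivity) hq.ne', hashingBound]
      refine le_of_eq_of_le ?_ (le_add_of_nonneg_right hδ.le)
      ring

/-! ### A code of rate zero on which decoding always succeeds. -/

section StateCode

/-- Paulis with equal `X` parts have a diagonal product: a correct `X` estimate leaves only a phase
error. -/
theorem Pauli.mul_apply_ne {P Q : Pauli} (h : P.xBit = Q.xBit) {x y : Fin 2} (hxy : x ≠ y) :
    (P.mat * Q.mat) x y = 0 := by
  cases P <;> cases Q <;> simp [xBit] at h <;> fin_cases x <;> fin_cases y <;>
    simp [mat] at hxy ⊢

theorem Pauli.norm_mul_apply_self {P Q : Pauli} (h : P.xBit = Q.xBit) (x : Fin 2) :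
    ‖(P.mat * Q.mat) x x‖ = 1 := by
  cases P <;> cases Q <;> simp [xBit] at h <;> fin_cases x <;> simp [mat]

theorem PauliString.op_mulVec_op_mulVec {n : ℕ} {E F : PauliString n} (h : E.xPart = F.xPart)
    (ψ : QubitSpace n) (s : Fin n → Fin 2) :
    E.op.mulVec (F.op.mulVec ψ) s = (∏ i, ((E i).mat * (F i).mat) (s i) (s i)) * ψ s := by
  rw [Matrix.mulVec_mulVec, Matrix.mulVec, dotProduct, Finset.sum_eq_single s]
  · rw [op_mul_apply]
  · intro t _ hts
    obtain ⟨i, hi⟩ := Function.ne_iff.1 hts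
    rw [op_mul_apply, Finset.prod_eq_zero (Finset.mem_univ i)
      (Pauli.mul_apply_ne (congrFun h i) (Ne.symm hi)), zero_mul]
  · simp

/-- There is a code encoding no qubits, and decoding never fails on it. -/
theorem exists_code_errorProb_eq_zero (n : ℕ) :
    ∃ C : CSSCode n, C.Encodes 0 ∧ ∀ (D : CorrelatedDecoder C) (p : ℝ), D.errorProb p = 0 := by
  -- All `n` generators are of `Z` type, and with `g = 1` they read off every bit. The `X` estimate
  -- is therefore exact, and code states live on the zero label.
  let e : Fin 0 ⊕ Fin n ⊕ Fin 0 ≃ Fin n := Fintype.equivOfCardEq (by simp)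
  have hdot : ∀ (j : Fin n) (u : Fin n → ZMod 2),
      (CSSCode.ofGL e 1).HZ j ⬝ᵥ u = u (e (.inr (.inl j))) := by
    intro j u
    have h := CSSCode.ofGL_HZ_dotProduct e 1 j u
    rwa [Units.val_one, Matrix.vecMul_one] at h
  have hsurj : ∀ i : Fin n, ∃ j : Fin n, e (.inr (.inl j)) = i := by
    intro i
    obtain ⟨(j | j | j), hj⟩ := e.surjective i
    · exact j.elim0
    · exact ⟨j, hj⟩
    · exact j.elim0
  refine ⟨CSSCode.ofGL e 1, CSSCode.ofGL_encodes e 1, fun D p => ?_⟩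
  refine Finset.sum_eq_zero fun E _ => if_pos ?_
  have hX : (D.decode E).xPart = E.xPart := by
    rw [CorrelatedDecoder.decode, PauliString.xPart_ofParts]
    have h := (D.decodeX_spec ((CSSCode.ofGL e 1).sZ E) ⟨_, (CSSCode.sZ_eq _ E).symm⟩).1
    rw [CSSCode.sZ_eq] at h ⊢
    funext i
    obtain ⟨j, rfl⟩ := hsurj i
    have hj := congrFun h j
    exact (hdot j _).symm.trans (hj.trans (hdot j _))
  -- The residual operator is diagonal, so only its entry at the zero label acts on code states.
  refine ⟨∏ i, (((D.decode E) i).mat * (E i).mat) 0 0, ?_, fun ψ hψ => ?_⟩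
  · rw [norm_prod]
    exact Finset.prod_eq_one fun i _ => Pauli.norm_mul_apply_self (congrFun hX i) 0
  · funext s
    rw [PauliString.op_mulVec_op_mulVec hX, Pi.smul_apply, smul_eq_mul]
    by_cases hs : s = 0
    · rw [hs]
      rfl
    · obtain ⟨i, hi⟩ := Function.ne_iff.1 hs
      obtain ⟨j, rfl⟩ := hsurj i
      have h0 : ψ s = 0 := by
        have := ((CSSCode.mem_codeSpace_iff _ _).1 hψ).2 j (bits n s)
          (by rw [hdot]; exact hi)
        simpa using this
      rw [h0, mul_zero, mul_zero]

end StateCode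

/-! ### Assembly. -/

/-- Below probability `3 / 4`, every rate less than the hashing bound is achieved with
exponentially small error probability. -/
theorem exists_code_of_lt_hashingBound {p : ℝ} (hp0 : 0 ≤ p) (hp : p < 3 / 4) {ε : ℝ}
    (hε : 0 < ε) (hεp : ε ≤ hashingBound p) :
    ∃ c d : ℝ, 0 ≤ c ∧ c < 1 ∧ 0 ≤ d ∧ d < 1 ∧ ∀ n : ℕ, ∃ (C : CSSCode n) (k : ℕ),
      C.Encodes k ∧ (hashingBound p - ε) * n ≤ k ∧
      ∀ D : CorrelatedDecoder C, D.errorProb p ≤ 2 * c ^ n + 2 * d ^ n := by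
  have hp1 : p ≤ 1 := by linarith
  -- The loss `ε` is split in three: one third for the weights, one for each strict excess over the
  -- critical rates.
  obtain ⟨μ, ν, hμ0, hμ1, hν0, hν1, hrate⟩ :=
    exists_rateX_add_rateZ_le hp0 hp (δ := ε / 3) (by positivity)
  have hX0 := rateX_nonneg hp0 hp1 hμ0
  have hZ0 := rateZ_nonneg hp0 hp1 hν0
  obtain ⟨c, hc0, hc1, hc⟩ := exists_sum_prod_mul_min_le
    (w := Pauli.depolarizing p) (a := fun P => weightFactor μ False P.xBit)
    (Pauli.depolarizing_nonneg hp0 hp1) (Pauli.sum_depolarizing p)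
    (fun P => one_pos.trans_le (one_le_weightFactor hμ0 _ _)) (R := rateX p μ + ε / 3)
    (lt_add_of_pos_right _ (by positivity))
  obtain ⟨d, hd0, hd1, hd⟩ := exists_sum_prod_mul_min_le
    (w := Pauli.depolarizing p) (a := fun P => weightFactor ν (P.xBit ≠ 0) P.zBit)
    (Pauli.depolarizing_nonneg hp0 hp1) (Pauli.sum_depolarizing p)
    (fun P => one_pos.trans_le (one_le_weightFactor hν0 _ _)) (R := rateZ p ν + ε / 3)
    (lt_add_of_pos_right _ (by positivity))
  refine ⟨c, d, hc0, hc1, hd0, hd1, fun n => ?_⟩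
  have hn : (0 : ℝ) ≤ n := Nat.cast_nonneg n
  obtain ⟨rZ, hrZ, hrZ'⟩ : ∃ r : ℕ, (r : ℝ) ≤ (rateX p μ + ε / 3) * n ∧
      (rateX p μ + ε / 3) * n - 1 ≤ r :=
    ⟨_, Nat.floor_le (by positivity), (Nat.sub_one_lt_floor _).le⟩
  -- `X`-type generators detect `Z` errors, so their number is governed by `rateZ`.
  obtain ⟨rX, hrX, hrX'⟩ : ∃ r : ℕ, (r : ℝ) ≤ (rateZ p ν + ε / 3) * n ∧
      (rateZ p ν + ε / 3) * n - 1 ≤ r :=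
    ⟨_, Nat.floor_le (by positivity), (Nat.sub_one_lt_floor _).le⟩
  have hsum : (rX + rZ : ℝ) ≤ (1 - hashingBound p + ε) * n := by
    have := mul_le_mul_of_nonneg_right hrate hn
    linarith
  have hle : rX + rZ ≤ n := by
    have : (rX + rZ : ℝ) ≤ n := hsum.trans (mul_le_of_le_one_left hn (by linarith))
    exact_mod_cast this
  obtain ⟨k, hk⟩ := Nat.exists_eq_add_of_le hle
  have hkR : (n : ℝ) = rX + rZ + k := by exact_mod_cast hk
  obtain ⟨C, hC, hD⟩ := exists_code_errorProb_le
    (Fintype.equivOfCardEq (by simp; omega) : Fin rX ⊕ Fin rZ ⊕ Fin k ≃ Fin n)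
    hp0 hp1 hμ0 hμ1 hν0 hν1
  refine ⟨C, k, hC, by linarith, fun D => (hD D).trans (add_le_add ?_ ?_)⟩
  · exact hc n rZ hrZ'
  · exact hd n rX hrX'

end CSS

theorem mainTheorem1 (p : ℝ) (hp0 : 0 ≤ p) (hp1 : p ≤ 1) (ε : ℝ) (hε : 0 < ε) :
    ∃ (C : ∀ n : ℕ, CSS.CSSCode n) (k : ℕ → ℕ),
      (∀ n, (C n).Encodes (k n)) ∧
      (∀ n, 0 < n → CSS.hashingBound p - ε ≤ (k n : ℝ) / (n : ℝ)) ∧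
      ∀ D : ∀ n, CSS.CorrelatedDecoder (C n),
        Tendsto (fun n => (D n).errorProb p) atTop (𝓝 0) := by
  -- If the required rate is not positive, the code with `k = 0` suffices; this covers all `p ≥ 3 /
  -- 4`.
  rcases le_or_gt (CSS.hashingBound p) ε with h | h
  · choose C hC hD using CSS.exists_code_errorProb_eq_zero
    refine ⟨C, fun _ => 0, hC, fun n _ => ?_, fun D => ?_⟩
    · simpa using h
    · simp only [hD]
      exact tendsto_const_nhds
  · have hp : p < 3 / 4 := by
      by_contra! hp
      linarith [CSS.hashingBound_nonpos hp hp1]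
    obtain ⟨c, d, hc0, hc1, hd0, hd1, hcode⟩ := CSS.exists_code_of_lt_hashingBound hp0 hp hε h.le
    choose C k hC hk hD using hcode
    refine ⟨C, k, hC, fun n hn => ?_, fun D => ?_⟩
    · rw [le_div_iff₀ (by exact_mod_cast hn)]
      exact hk n
    · refine squeeze_zero (fun n => (D n).errorProb_nonneg hp0 hp1) (fun n => hD n (D n)) ?_
      simpa using ((tendsto_pow_atTop_nhds_zero_of_lt_one hc0 hc1).const_mul 2).add
        ((tendsto_pow_atTop_nhds_zero_of_lt_one hd0 hd1).const_mul 2)
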